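/- Let $A$ be a finite alphabet with $d=|A|\ge 2$ letters and let $T$ be the regular rooted tree whose vertices are the finite words over $A$, the root being the empty word, with an edge between $v$ and $va$ for every word $v$ and letter $a$. Let $\mathrm{Aut}(T)$ be the group of graph automorphisms of $T$, let $V_k$ be the set of words of length $k$, and let $X=\partial T$ be the set of infinite paths without backtracking from the root, identified with $A^{\mathbb N}$ and equipped with the uniform Bernoulli measure $\mu$, so that the set of paths through a given $v\in V_k$ has measure $d^{-k}$. For a subgroup $G<\mathrm{Aut}(T)$ and a vertex $v$, let $\mathrm{rist}_G(v)$ be the subgroup of those elements of $G$ that act trivially outside the subtree $T_v$ of words having $v$ as a prefix, and let $\mathrm{rist}_G(k)=\langle \mathrm{rist}_G(v): v\in V_k\rangle$. The group $G$ is called weakly branch if it acts transitively on $V_k$ and $\mathrm{rist}_G(k)$ is infinite for every $k\ge 0$. For $n\ge 0$ let $X^n_{\mathrm{Sym}}=X^n/\mathrm{Sym}(n)$ be the quotient of $X^n$ by permutations of coordinates, $\gamma_n:X^n\to X^n_{\mathrm{Sym}}$ the quotient map, $\Sigma^n_{\mathrm{Sym}}$ the $\sigma$-algebra of all $B\subset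 X^n_{\mathrm{Sym}}$ whose preimage $\gamma_n^{-1}(B)$ is measurable in $X^n$, and $\mu^n_{\mathrm{Sym}}=(\gamma_n)_*\mu^n$. The group $G$ acts on $X^n_{\mathrm{Sym}}$ by $\mathrm{diag}_n(g)\,\gamma_n(x_1,\dots,x_n)=\gamma_n(gx_1,\dots,gx_n)$. **Theorem.** If $G<\mathrm{Aut}(T)$ is a countable weakly branch group, then for every $n$ the action $\mathrm{diag}_n$ of $G$ on $(X^n_{\mathrm{Sym}},\Sigma^n_{\mathrm{Sym}},\mu^n_{\mathrm{Sym}})$ is totally non-free. That is, the action is measure preserving, and the fixed-point sets $\mathrm{Fix}(\mathrm{diag}_n(g))=\{y\in X^n_{\mathrm{Sym}}:\mathrm{diag}_n(g)y=y\}$, $g\in G$, are measurable and generate the $\sigma$-algebra modulo null sets: for every $B\subset X^n_{\mathrm{Sym}}$ that is measurable (or, more generally, measurable with respect to the completion of $\mu^n_{\mathrm{Sym}}$) there is a set $C$ in the $\sigma$-algebra generated by the sets $\mathrm{Fix}(\mathrm{diag}_n(g))$, $g\in G$, such that $\mu^n_{\mathrm{Sym}}(B\,\Delta\,C)=0$.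 -/

import Mathlib

open MeasureTheory

/-! ### Regular rooted trees and their automorphisms -/

/-- The regular rooted tree over the alphabet `A`. Its vertices are the finite words over `A`;
two vertices are joined if one arises from the other by appending a letter at the end.
The root is the empty word. -/
def regularTree (A : Type*) : SimpleGraph (List A) where
  Adj v w := (∃ a, w = v ++ [a]) ∨ ∃ a, v = w ++ [a]
  symm := ⟨fun _ _ h => h.symm⟩
  loopless := ⟨by
    rintro v (⟨a, h⟩ | ⟨a, h⟩) <;> simpa using congrArg List.length h⟩

/-- `Aut(T)`: all graph automorphisms of the regular rooted tree, with composition. -/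
abbrev TreeAut (A : Type*) := regularTree A ≃g regularTree A

namespace TreeAut

variable {A : Type*}

/-- Automorphisms fix the root, the only vertex without a parent. -/
theorem apply_root [Finite A] (g : TreeAut A) : g [] = [] := by
  classical
  by_contra hne
  obtain ⟨u, b, hu⟩ : ∃ u b, g [] = u ++ [b] :=
    ⟨_, _, (List.dropLast_append_getLast hne).symm⟩
  have key : ∀ w, (regularTree A).Adj (g []) w → ∃ a, g [a] = w := by
    intro w hw
    have h : (regularTree A).Adj [] (g.symm w) := by
      rw [← g.map_adj_iff]
      simpa using hw
    rcases h with ⟨a, ha⟩ | ⟨a, ha⟩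
    · refine ⟨a, ?_⟩
      rw [show [a] = g.symm w by simpa using ha.symm]
      simp
    · simp at ha
  let f : Option A → List A := fun o => o.elim u (fun a => (u ++ [b]) ++ [a])
  have hf : Function.Injective f := by
    intro o o' h
    cases o <;> cases o' <;> simp [f] at h ⊢
    exact h
  have hadj : ∀ o, (regularTree A).Adj (g []) (f o) := by
    intro o
    rw [hu]
    cases o with
    | none => exact Or.inr ⟨b, rfl⟩
    | some a => exact Or.inl ⟨a, rfl⟩
  choose k hk using fun o => key (f o) (hadj o)
  have hkinj : Function.Injective k := by
    intro o o' h
    apply hf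
    rw [← hk o, ← hk o', h]
  have := Fintype.ofFinite A
  have h1 := Fintype.card_le_of_injective k hkinj
  simp at h1

/-- Automorphisms respect levels and the relation "parent of". -/
theorem apply_append_singleton [Finite A] (g : TreeAut A) (v : List A) (a : A) :
    ∃ b, g (v ++ [a]) = g v ++ [b] := by
  induction v using List.reverseRecOn generalizing a with
  | nil =>
    have h : (regularTree A).Adj (g []) (g ([] ++ [a])) := g.map_adj_iff.2 (Or.inl ⟨a, rfl⟩)
    rcases h with h | ⟨b, hb⟩
    · exact h
    · rw [apply_root] at hb
      simp at hb
  | append_singleton u c ih =>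
    have h : (regularTree A).Adj (g (u ++ [c])) (g (u ++ [c] ++ [a])) :=
      g.map_adj_iff.2 (Or.inl ⟨a, rfl⟩)
    rcases h with h | ⟨b, hb⟩
    · exact h
    · obtain ⟨b', hb'⟩ := ih c
      rw [hb'] at hb
      have h2 := g.injective (List.append_inj_left' hb rfl)
      simpa using congrArg List.length h2

theorem length_apply [Finite A] (g : TreeAut A) (v : List A) : (g v).length = v.length := by
  induction v using List.reverseRecOn with
  | nil => simp [apply_root]
  | append_singleton u c ih =>
    obtain ⟨b, hb⟩ := apply_append_singleton g u c
    simp [hb, ih]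

end TreeAut

/-! ### The boundary of the tree -/

/-- The boundary `∂T`: infinite paths without backtracking from the root, encoded by the infinite
sequence of letters read along the path. -/
abbrev Boundary (A : Type*) := ℕ → A

namespace Boundary

variable {A : Type*}

/-- The vertex of level `n` on the path `x`. -/
def vertex (x : Boundary A) (n : ℕ) : List A := (List.range n).map x

@[simp] theorem length_vertex (x : Boundary A) (n : ℕ) : (x.vertex n).length = n := by
  simp [vertex]

theorem vertex_succ (x : Boundary A) (n : ℕ) : x.vertex (n + 1) = x.vertex n ++ [x n] := by
  simp [vertex, List.range_succ]

theorem ext_vertex {x y : Boundary A} (h : ∀ n, x.vertex n = y.vertex n) : x = y := by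
  funext n
  have h1 := h (n + 1)
  rw [vertex_succ, vertex_succ, h n] at h1
  simpa using h1

/-- An automorphism acts on the boundary by moving the vertices of a path; see `vertex_smul`. -/
instance [Finite A] : SMul (TreeAut A) (Boundary A) where
  smul g x := fun n => (g (x.vertex (n + 1)))[n]'(by simp [TreeAut.length_apply])

theorem vertex_smul [Finite A] (g : TreeAut A) (x : Boundary A) (n : ℕ) :
    (g • x).vertex n = g (x.vertex n) := by
  induction n with
  | zero => exact (TreeAut.apply_root g).symm
  | succ n ih =>
    have hn : (g • x) n = (g (x.vertex (n + 1)))[n]'(by simp [TreeAut.length_apply]) := rfl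
    obtain ⟨b, hb⟩ := TreeAut.apply_append_singleton g (x.vertex n) (x n)
    rw [← vertex_succ] at hb
    have hb' : (g (x.vertex (n + 1)))[n]'(by simp [TreeAut.length_apply]) = b := by
      simp [hb, TreeAut.length_apply]
    rw [vertex_succ, ih, hn, hb', hb]

instance [Finite A] : MulAction (TreeAut A) (Boundary A) where
  one_smul x := ext_vertex fun n => by rw [vertex_smul]; rfl
  mul_smul g h x := ext_vertex fun n => by simp only [vertex_smul]; rfl

end Boundary

/-- The uniform Bernoulli measure on the boundary: the infinite product of the uniform
probability measure on the alphabet. -/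
noncomputable def bernoulliMeasure (A : Type*) [Fintype A] [Nonempty A] [MeasurableSpace A] :
    Measure (Boundary A) :=
  Measure.infinitePi (X := fun _ : ℕ => A) fun _ => (PMF.uniformOfFintype A).toMeasure

/-! ### Weakly branch groups -/

section Branch

variable {A : Type*}

/-- The rigid stabilizer `rist_G(v)`: the elements of `G` acting trivially on the complement of
the subtree `T_v`, which consists of the words having `v` as a prefix. -/
def rist (G : Subgroup (TreeAut A)) (v : List A) : Subgroup (TreeAut A) where
  carrier := {g | g ∈ G ∧ ∀ w, ¬ v <+: w → g w = w}
  one_mem' := ⟨G.one_mem, fun _ _ => rfl⟩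
  mul_mem' := by
    rintro g h ⟨hg, hg'⟩ ⟨hh, hh'⟩
    refine ⟨G.mul_mem hg hh, fun w hw => ?_⟩
    rw [RelIso.mul_apply, hh' w hw, hg' w hw]
  inv_mem' := by
    rintro g ⟨hg, hg'⟩
    refine ⟨G.inv_mem hg, fun w hw => ?_⟩
    conv_lhs => rw [← hg' w hw]
    exact RelIso.inv_apply_self g w

/-- The rigid stabilizer `rist_G(n)` of the `n`-th level: the subgroup generated by the rigid
stabilizers of the vertices of level `n`. -/
def ristLevel (G : Subgroup (TreeAut A)) (n : ℕ) : Subgroup (TreeAut A) :=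
  ⨆ v : {v : List A // v.length = n}, rist G v

/-- `G` is weakly branch: transitive on every level, with all level rigid stabilizers infinite. -/
structure IsWeaklyBranch (G : Subgroup (TreeAut A)) : Prop where
  level_transitive : ∀ v w : List A, v.length = w.length → ∃ g ∈ G, g v = w
  infinite_rist : ∀ n : ℕ, Infinite (ristLevel G n)

end Branch

/-! ### Symmetrized powers -/

/-- Two points of `X ^ n` are equivalent if they differ by a permutation of the coordinates. -/
def permSetoid (X : Type*) (n : ℕ) : Setoid (Fin n → X) where
  r x y := ∃ σ : Equiv.Perm (Fin n), x ∘ σ = y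
  iseqv :=
    { refl := fun _ => ⟨1, rfl⟩
      symm := by
        rintro x _ ⟨σ, rfl⟩
        exact ⟨σ⁻¹, by funext i; simp⟩
      trans := by
        rintro x _ _ ⟨σ, rfl⟩ ⟨τ, rfl⟩
        exact ⟨σ * τ, rfl⟩ }

/-- The symmetrized power `X ^ n / Sym(n)`. -/
def SymPower (X : Type*) (n : ℕ) := Quotient (permSetoid X n)

namespace SymPower

variable {X : Type*} {n : ℕ}

/-- The quotient map `X ^ n → X ^ n / Sym(n)`. -/
def proj (x : Fin n → X) : SymPower X n := Quotient.mk (permSetoid X n) x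

/-- A set is measurable iff its preimage under `proj` is measurable in the product `X ^ n`. -/
instance [MeasurableSpace X] : MeasurableSpace (SymPower X n) :=
  MeasurableSpace.map proj inferInstance

/-- The action induced by the diagonal action on `X ^ n`. -/
instance {G : Type*} [Group G] [MulAction G X] : MulAction G (SymPower X n) where
  smul g := Quotient.map (sa := permSetoid X n) (sb := permSetoid X n) (fun x i => g • x i) (by
    rintro x _ ⟨σ, rfl⟩
    exact ⟨σ, rfl⟩)
  one_smul := by
    rintro ⟨x⟩
    exact congrArg proj (funext fun i => one_smul G (x i))
  mul_smul g h := by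
    rintro ⟨x⟩
    exact congrArg proj (funext fun i => mul_smul g h (x i))

theorem smul_proj {G : Type*} [Group G] [MulAction G X] (g : G) (x : Fin n → X) :
    g • proj x = proj (fun i => g • x i) := rfl

end SymPower

/-- The image on `X ^ n / Sym(n)` of the product measure `μ ^ n`. -/
noncomputable def symPowerMeasure {X : Type*} [MeasurableSpace X] (μ : Measure X) (n : ℕ) :
    Measure (SymPower X n) :=
  (Measure.pi fun _ : Fin n => μ).map SymPower.proj

/-! ### Totally non-free actions -/

/-- The action of `G` on `(X, μ)` is totally non-free: it is measure preserving, and the sets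
`Fix(g)` are measurable and generate the σ-algebra of `X` modulo null sets. The latter is required
for the completed σ-algebra, so it holds a fortiori for the given one. -/
structure IsTotallyNonFree (G : Type*) {X : Type*} [Group G] [MulAction G X] [MeasurableSpace X]
    (μ : Measure X) : Prop where
  measurePreserving : ∀ g : G, MeasurePreserving (fun x : X => g • x) μ μ
  measurableSet_fix : ∀ g : G, MeasurableSet {x : X | g • x = x}
  generates : ∀ B : Set X, NullMeasurableSet B μ →
    ∃ C : Set X,
      MeasurableSet[MeasurableSpace.generateFrom
        (Set.range fun g : G => {x : X | g • x = x})] C ∧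
      μ (symmDiff B C) = 0

/-! Since `μ` has no atoms, almost every tuple has distinct entries. If `x` is such a tuple and `y`
represents another class, some `x i` is not an entry of `y`. A deep enough vertex `v` on the path `x
i` is then avoided by all entries of `y` and all other entries of `x`. Weak branching gives an
element of `rist G v` moving `x i`; it fixes the class of `y` but not that of `x`
(`IsWeaklyBranch.exists_smul_ne_and_smul_eq`). Hence the fixed-point sets, countably many, separate
the classes of almost all tuples. Lusin separation of analytic sets turns this into generation
modulo null sets (`exists_measurableSet_generateFrom_symmDiff_null`); it is applied to images of
subsets of `X ^ n`, so the quotient need not be shown to be standard Borel. -/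

namespace TreeAut

variable {A : Type*}

theorem apply_prefix [Finite A] (g : TreeAut A) {v w : List A} (h : v <+: w) : g v <+: g w := by
  obtain ⟨u, rfl⟩ := h
  induction u using List.reverseRecOn with
  | nil => simp
  | append_singleton u a ih =>
    obtain ⟨b, hb⟩ := apply_append_singleton g (v ++ u) a
    rw [← List.append_assoc, hb]
    exact ih.trans (List.prefix_append _ _)

theorem apply_prefix_iff [Finite A] (g : TreeAut A) {v w : List A} : g v <+: g w ↔ v <+: w := by
  refine ⟨fun h => ?_, apply_prefix g⟩
  simpa using apply_prefix g.symm h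

end TreeAut

namespace Boundary

variable {A : Type*}

theorem vertex_prefix (x : Boundary A) {m n : ℕ} (h : m ≤ n) : x.vertex m <+: x.vertex n := by
  induction n, h using Nat.le_induction with
  | base => exact List.prefix_rfl
  | succ n _ ih => exact ih.trans (by rw [vertex_succ]; exact List.prefix_append _ _)

theorem prefix_vertex_iff (x : Boundary A) {v : List A} {n : ℕ} (h : v.length ≤ n) :
    v <+: x.vertex n ↔ x.vertex v.length = v := by
  constructor
  · intro hv
    exact (List.prefix_of_prefix_length_le hv (vertex_prefix x h) (by simp)).eq_of_length
      (by simp) |>.symm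
  · intro hv
    rw [← hv]
    simpa using vertex_prefix x h

theorem vertex_eq_iff {x y : Boundary A} {n : ℕ} :
    x.vertex n = y.vertex n ↔ ∀ i < n, x i = y i := by
  simp [vertex]

/-- Rigid stabilizers move only points whose path runs through the given vertex. -/
theorem smul_eq_of_mem_rist [Finite A] {G : Subgroup (TreeAut A)} {v : List A} {g : TreeAut A}
    (hg : g ∈ rist G v) {x : Boundary A} (hx : x.vertex v.length ≠ v) : g • x = x := by
  have key : ∀ m, v.length ≤ m → (g • x).vertex m = x.vertex m := fun m hm => by
    rw [vertex_smul]
    exact hg.2 _ fun h => hx ((prefix_vertex_iff x hm).1 h)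
  funext i
  exact vertex_eq_iff.1 (key (max v.length (i + 1)) (le_max_left _ _)) i
    (lt_of_lt_of_le (Nat.lt_succ_self i) (le_max_right _ _))

end Boundary

/-! ### Separating unordered tuples by rigid stabilizers -/

theorem IsWeaklyBranch.exists_rist_ne_bot {A : Type*} {G : Subgroup (TreeAut A)}
    (hG : IsWeaklyBranch G) (n : ℕ) : ∃ v : List A, v.length = n ∧ rist G v ≠ ⊥ := by
  by_contra! h
  have hbot : ristLevel G n = ⊥ := by
    rw [ristLevel, iSup_eq_bot]
    exact fun v => h v.1 v.2
  have := hG.infinite_rist n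
  rw [hbot] at this
  exact not_finite (⊥ : Subgroup (TreeAut A))

/-- The rigid stabilizer of a vertex has no fixed points among the paths through that vertex. -/
theorem IsWeaklyBranch.exists_mem_rist_smul_ne {A : Type*} [Finite A] {G : Subgroup (TreeAut A)}
    (hG : IsWeaklyBranch G) (x : Boundary A) (n : ℕ) :
    ∃ g ∈ rist G (x.vertex n), g • x ≠ x := by
  obtain ⟨u, hu, hne⟩ := hG.exists_rist_ne_bot n
  obtain ⟨g, hg, hg1⟩ := (Subgroup.bot_or_exists_ne_one _).resolve_left hne
  obtain ⟨w, hw⟩ : ∃ w, g w ≠ w := by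
    by_contra! h
    exact hg1 (RelIso.ext h)
  have huw : u <+: w := by
    by_contra h
    exact hw (hg.2 w h)
  -- Transitivity is used at the level of the moved word `w`, not at level `n`: the conjugate of `g`
  -- by `h` then moves the path `x` itself at that level.
  obtain ⟨h, hh, hhw⟩ := hG.level_transitive (x.vertex w.length) w (by simp)
  have hn : n ≤ w.length := hu ▸ huw.length_le
  have hhu : h (x.vertex n) = u := by
    have h1 : h (x.vertex n) <+: w := by
      rw [← hhw]
      exact TreeAut.apply_prefix h (Boundary.vertex_prefix x hn)
    refine (List.prefix_of_prefix_length_le h1 huw ?_).eq_of_length ?_ <;>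
      simp [TreeAut.length_apply, hu]
  refine ⟨h⁻¹ * g * h, ⟨G.mul_mem (G.mul_mem (G.inv_mem hh) hg.1) hh, fun z hz => ?_⟩, fun he => ?_⟩
  · rw [RelIso.mul_apply, RelIso.mul_apply, hg.2 (h z), RelIso.inv_apply_self]
    rwa [← hhu, TreeAut.apply_prefix_iff]
  · have h2 := congrArg (fun y => Boundary.vertex y w.length) he
    simp only [Boundary.vertex_smul, RelIso.mul_apply, hhw] at h2
    apply hw
    have h3 := congrArg h h2
    rwa [RelIso.apply_inv_self, hhw] at h3

theorem Boundary.exists_vertex_ne {A : Type*} (x : Boundary A) {s : Set (Boundary A)}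
    (hs : s.Finite) (hx : x ∉ s) : ∃ n, ∀ y ∈ s, y.vertex n ≠ x.vertex n := by
  have : ∀ᶠ n in Filter.atTop, ∀ y ∈ s, y.vertex n ≠ x.vertex n := by
    rw [Filter.eventually_all_finite hs]
    intro y hy
    have hyx : y ≠ x := fun h => hx (h ▸ hy)
    obtain ⟨i, hi⟩ := Function.ne_iff.1 hyx
    filter_upwards [Filter.eventually_gt_atTop i] with n hn h
    exact hi (Boundary.vertex_eq_iff.1 h i hn)
  exact this.exists

/-- Fixed-point sets separate an unordered tuple with distinct entries from any other one. -/
theorem IsWeaklyBranch.exists_smul_ne_and_smul_eq {A : Type*} [Finite A]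
    {G : Subgroup (TreeAut A)} (hG : IsWeaklyBranch G) {n : ℕ} {x y : Fin n → Boundary A}
    (hx : Function.Injective x)
    (hxy : SymPower.proj x ≠ SymPower.proj y) :
    ∃ g : G, g • SymPower.proj x ≠ SymPower.proj x ∧ g • SymPower.proj y = SymPower.proj y := by
  -- Otherwise `x = y ∘ f` with `f` injective, hence a permutation of the finite index set.
  obtain ⟨i, hi⟩ : ∃ i, x i ∉ Set.range y := by
    by_contra! h
    choose f hf using h
    have hfi : Function.Injective f := fun a b hab => hx (by rw [← hf a, ← hf b, hab])
    refine hxy (Quotient.sound ((permSetoid (Boundary A) n).symm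
      ⟨Equiv.ofBijective f (Finite.injective_iff_bijective.1 hfi), funext hf⟩))
  obtain ⟨k, hk⟩ := (x i).exists_vertex_ne (s := Set.range y ∪ (Set.range x \ {x i}))
    ((Set.finite_range y).union ((Set.finite_range x).sdiff)) (by simpa using hi)
  obtain ⟨g, hg, hgx⟩ := hG.exists_mem_rist_smul_ne (x i) k
  have hfix : ∀ z ∈ Set.range y ∪ (Set.range x \ {x i}), g • z = z := fun z hz =>
    Boundary.smul_eq_of_mem_rist hg (by simpa using hk z hz)
  have hgG : g ∈ G := hg.1
  refine ⟨⟨g, hgG⟩, fun h => ?_, ?_⟩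
  · change SymPower.proj (fun j => g • x j) = SymPower.proj x at h
    obtain ⟨σ, hσ⟩ := Quotient.exact h
    -- This says `g • x i = x (σ⁻¹ i)`. An entry other than `x i` is already fixed by `g`, so it
    -- cannot also be the image of `x i`.
    have h1 := congrFun hσ (σ.symm i)
    simp only [Function.comp_apply, Equiv.apply_symm_apply] at h1
    by_cases h2 : x (σ.symm i) = x i
    · exact hgx (h1.trans h2)
    · have h3 := hfix (x (σ.symm i)) (Or.inr ⟨⟨_, rfl⟩, h2⟩)
      exact h2 (MulAction.injective g (h3.trans h1.symm))
  · exact congrArg SymPower.proj (funext fun j => hfix (y j) (Or.inl ⟨j, rfl⟩))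

/-! ### Cylinders and the Bernoulli measure -/

open scoped ENNReal

namespace Boundary

variable {A : Type*}

/-- The set of paths through the vertex `v`. -/
def cylinder (v : List A) : Set (Boundary A) := {x | x.vertex v.length = v}

theorem cylinder_eq_pi (v : List A) :
    cylinder v = (Finset.range v.length : Set ℕ).pi fun i => {a | v[i]? = some a} := by
  ext x
  simp only [cylinder, Set.mem_ofPred_eq, Set.mem_pi, Finset.coe_range, Set.mem_Iio]
  constructor
  · intro h i hi
    rw [← h]
    simp [vertex, hi]
  · intro h
    refine List.ext_getElem (by simp) fun i h1 h2 => ?_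
    have := h i h2
    rw [List.getElem?_eq_getElem h2, Option.some.injEq] at this
    simp [vertex, this]

theorem mem_cylinder_vertex (x : Boundary A) (n : ℕ) : x ∈ cylinder (x.vertex n) := by
  simp [cylinder]

theorem smul_mem_cylinder_iff [Finite A] (g : TreeAut A) (x : Boundary A) (v : List A) :
    g • x ∈ cylinder v ↔ x ∈ cylinder (g⁻¹ v) := by
  simp only [cylinder, Set.mem_ofPred_eq, vertex_smul, TreeAut.length_apply]
  constructor
  · intro h
    rw [← RelIso.inv_apply_self g (x.vertex v.length), h]
  · intro h
    rw [h, RelIso.apply_inv_self]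

/-- Two cylinders are nested or disjoint. -/
theorem isPiSystem_cylinder : IsPiSystem (Set.range (cylinder (A := A))) := by
  rintro _ ⟨v, rfl⟩ _ ⟨w, rfl⟩ ⟨x, hv, hw⟩
  have aux : ∀ {v w : List A}, v.length ≤ w.length → x ∈ cylinder v → x ∈ cylinder w →
      cylinder w ⊆ cylinder v := by
    intro v w hvw hv hw y hy
    have h1 : y.vertex w.length = x.vertex w.length := hy.trans hw.symm
    have h2 : y.vertex v.length = x.vertex v.length :=
      vertex_eq_iff.2 fun i hi => vertex_eq_iff.1 h1 i (hi.trans_le hvw)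
    exact h2.trans hv
  rcases le_total v.length w.length with h | h
  · exact ⟨w, (Set.inter_eq_right.2 (aux h hv hw)).symm⟩
  · exact ⟨v, (Set.inter_eq_left.2 (aux h hw hv)).symm⟩

section Measurable

variable [Finite A] [MeasurableSpace A] [MeasurableSingletonClass A]

theorem measurableSet_cylinder (v : List A) : MeasurableSet (cylinder v) := by
  rw [cylinder_eq_pi]
  exact .pi (Finset.countable_toSet _) fun _ _ => .of_discrete

theorem generateFrom_cylinder :
    MeasurableSpace.generateFrom (Set.range (cylinder (A := A))) = MeasurableSpace.pi := by
  apply le_antisymm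
  · apply MeasurableSpace.generateFrom_le
    rintro _ ⟨v, rfl⟩
    exact measurableSet_cylinder v
  · refine iSup_le fun i => ?_
    rintro _ ⟨s, -, rfl⟩
    -- The letter `x i` is determined by the vertex of level `i + 1`, and there are only countably
    -- many words.
    have : (fun x : Boundary A => x i) ⁻¹' s =
        ⋃ v ∈ {v : List A | ∃ x : Boundary A, x i ∈ s ∧ x.vertex (i + 1) = v}, cylinder v := by
      ext y
      simp only [Set.mem_preimage, Set.mem_iUnion, Set.mem_ofPred_eq, exists_prop]
      constructor
      · exact fun h => ⟨_, ⟨y, h, rfl⟩, mem_cylinder_vertex y _⟩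
      · rintro ⟨_, ⟨x, hx, rfl⟩, hy⟩
        have h1 : y.vertex (i + 1) = x.vertex (i + 1) := by simpa [cylinder] using hy
        rwa [vertex_eq_iff.1 h1 i i.lt_succ_self]
    rw [this]
    exact MeasurableSet.biUnion (Set.to_countable _) fun v _ =>
      MeasurableSpace.measurableSet_generateFrom ⟨v, rfl⟩

theorem measurable_smul (g : TreeAut A) : Measurable fun x : Boundary A => g • x := by
  suffices h : @Measurable _ _ MeasurableSpace.pi
      (MeasurableSpace.generateFrom (Set.range cylinder)) fun x : Boundary A => g • x by
    rwa [generateFrom_cylinder] at h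
  refine measurable_generateFrom ?_
  rintro _ ⟨v, rfl⟩
  have : (fun x : Boundary A => g • x) ⁻¹' cylinder v = cylinder (g⁻¹ v) :=
    Set.ext fun x => smul_mem_cylinder_iff g x v
  rw [this]
  exact measurableSet_cylinder _

end Measurable

end Boundary

section Bernoulli

open Boundary

variable {A : Type*} [Fintype A] [MeasurableSpace A] [MeasurableSingletonClass A]

instance [Nonempty A] : IsProbabilityMeasure (bernoulliMeasure A) := by
  unfold bernoulliMeasure
  infer_instance

theorem bernoulliMeasure_cylinder [Nonempty A] (v : List A) :
    bernoulliMeasure A (cylinder v) = ((Fintype.card A : ℝ≥0∞)⁻¹) ^ v.length := by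
  rw [cylinder_eq_pi, bernoulliMeasure, Measure.infinitePi_pi _ fun _ _ => .of_discrete]
  trans ∏ i ∈ Finset.range v.length, (Fintype.card A : ℝ≥0∞)⁻¹
  · refine Finset.prod_congr rfl fun i hi => ?_
    have : {a | v[i]? = some a} = {v[i]'(Finset.mem_range.1 hi)} := by
      ext a
      simp [List.getElem?_eq_getElem (Finset.mem_range.1 hi), eq_comm]
    rw [this, PMF.toMeasure_apply_singleton _ _ (.singleton _), PMF.uniformOfFintype_apply]
  · simp

/-- Automorphisms permute the cylinders of each level, which all have the same mass; cylinders form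
a generating π-system. -/
theorem measurePreserving_smul_bernoulliMeasure [Nonempty A] (g : TreeAut A) :
    MeasurePreserving (fun x : Boundary A => g • x) (bernoulliMeasure A) (bernoulliMeasure A) := by
  refine ⟨measurable_smul g, ?_⟩
  have := Measure.isProbabilityMeasure_map (μ := bernoulliMeasure A) (measurable_smul g).aemeasurable
  refine ext_of_generate_finite _ generateFrom_cylinder.symm isPiSystem_cylinder ?_ (by simp)
  rintro _ ⟨v, rfl⟩
  rw [Measure.map_apply (measurable_smul g) (measurableSet_cylinder v)]
  have : (fun x : Boundary A => g • x) ⁻¹' cylinder v = cylinder (g⁻¹ v) :=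
    Set.ext fun x => smul_mem_cylinder_iff g x v
  rw [this, bernoulliMeasure_cylinder, bernoulliMeasure_cylinder, TreeAut.length_apply]

instance [Nontrivial A] : NullSingletonClass (bernoulliMeasure A) where
  measure_singleton x := by
    have h : ∀ n, bernoulliMeasure A {x} ≤ ((Fintype.card A : ℝ≥0∞)⁻¹) ^ n := fun n => by
      calc bernoulliMeasure A {x} ≤ bernoulliMeasure A (cylinder (x.vertex n)) :=
            measure_mono (Set.singleton_subset_iff.2 (mem_cylinder_vertex x n))
        _ = _ := by rw [bernoulliMeasure_cylinder, length_vertex]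
    refine le_antisymm (ge_of_tendsto' (ENNReal.tendsto_pow_atTop_nhds_zero_of_lt_one ?_) h) bot_le
    rw [ENNReal.inv_lt_one]
    exact_mod_cast Fintype.one_lt_card

end Bernoulli

/-- Almost every tuple has distinct entries if the measure has no atoms. -/
theorem ae_injective_pi {X : Type*} [MeasurableSpace X] [MeasurableEq X] (μ : Measure X)
    [IsProbabilityMeasure μ] [NullSingletonClass μ] (n : ℕ) :
    ∀ᵐ x ∂(Measure.pi fun _ : Fin n => μ), Function.Injective x := by
  have h : ∀ i j : Fin n, i ≠ j → ∀ᵐ x ∂(Measure.pi fun _ : Fin n => μ), x i ≠ x j := by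
    intro i j hij
    -- Distinct coordinates are independent, so their joint law is `μ.prod μ`, for which the
    -- diagonal is null by Fubini.
    have hind := (ProbabilityTheory.iIndepFun_pi (μ := fun _ : Fin n => μ)
      (X := fun _ => id) fun _ => aemeasurable_id).indepFun hij
    simp only [id] at hind
    change ProbabilityTheory.IndepFun (Function.eval i) (Function.eval j) _ at hind
    rw [ProbabilityTheory.indepFun_iff_map_prod_eq_prod_map_map
      (measurePreserving_eval (fun _ : Fin n => μ) i).aemeasurable
      (measurePreserving_eval (fun _ : Fin n => μ) j).aemeasurable,
      (measurePreserving_eval (fun _ : Fin n => μ) i).map_eq,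
      (measurePreserving_eval (fun _ : Fin n => μ) j).map_eq] at hind
    have hm : MeasurableSet {p : X × X | p.1 = p.2} := measurableSet_diagonal
    have h0 : μ.prod μ {p : X × X | p.1 = p.2} = 0 := by
      rw [Measure.measure_prod_null hm]
      refine Filter.Eventually.of_forall fun a => ?_
      have : Prod.mk a ⁻¹' {p : X × X | p.1 = p.2} = {a} := by
        ext b; simp [eq_comm]
      simp [this]
    rw [← hind, Measure.map_apply ((measurable_pi_apply i).prodMk (measurable_pi_apply j)) hm] at h0
    rw [ae_iff]
    simpa using h0
  have h' : ∀ᵐ x ∂(Measure.pi fun _ : Fin n => μ), ∀ i j : Fin n, i ≠ j → x i ≠ x j := by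
    simp only [ae_all_iff]
    exact h
  filter_upwards [h'] with x hx i j hij
  by_contra hne
  exact hx i j hne hij

/-! ### Measurability and invariance on symmetrized powers -/

namespace SymPower

variable {X : Type*} [MeasurableSpace X] {n : ℕ}

theorem measurable_proj : Measurable (proj : (Fin n → X) → SymPower X n) := fun _ h => h

theorem measurableSet_iff {s : Set (SymPower X n)} :
    MeasurableSet s ↔ MeasurableSet (proj ⁻¹' s) := Iff.rfl

theorem measurePreserving_smul {G : Type*} [Group G] [MulAction G X] {μ : Measure X} [SigmaFinite μ]
    {g : G} (h : MeasurePreserving (fun x : X => g • x) μ μ) :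
    MeasurePreserving (fun y : SymPower X n => g • y) (symPowerMeasure μ n)
      (symPowerMeasure μ n) := by
  have hpi := measurePreserving_pi (fun _ : Fin n => μ) (fun _ => μ) (fun _ => h)
  have hm : Measurable fun y : SymPower X n => g • y := fun s hs =>
    hpi.measurable (measurable_proj hs)
  refine ⟨hm, ?_⟩
  rw [symPowerMeasure, Measure.map_map hm measurable_proj]
  conv_rhs => rw [← hpi.map_eq, Measure.map_map measurable_proj hpi.measurable]
  rfl

/-- Upstairs, being fixed means that `g • x` is one of the finitely many rearrangements of `x`. -/
theorem measurableSet_fixed {G : Type*} [Group G] [MulAction G X] [MeasurableEq X] {g : G}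
    (h : Measurable fun x : X => g • x) : MeasurableSet {y : SymPower X n | g • y = y} := by
  have : (proj ⁻¹' {y : SymPower X n | g • y = y} : Set (Fin n → X)) =
      ⋃ σ : Equiv.Perm (Fin n), ⋂ i, {x | g • x (σ i) = x i} := by
    ext x
    simp only [Set.mem_preimage, Set.mem_ofPred_eq, smul_proj, Set.mem_iUnion, Set.mem_iInter]
    exact ⟨fun h => (Quotient.exact h).imp fun σ hσ => congrFun hσ,
      fun ⟨σ, hσ⟩ => Quotient.sound ⟨σ, funext hσ⟩⟩
  rw [measurableSet_iff, this]
  exact .iUnion fun σ => .iInter fun i =>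
    measurableSet_eq_fun (h.comp (measurable_pi_apply _)) (measurable_pi_apply _)

end SymPower

/-- Countably many measurable sets of `Y` separating the images of almost all points of a standard
Borel space generate the σ-algebra of `Y` modulo null sets. -/
theorem exists_measurableSet_generateFrom_symmDiff_null {X Y ι : Type*} [MeasurableSpace X]
    [StandardBorelSpace X] [MeasurableSpace Y] [Countable ι] {μ : Measure X} {p : X → Y}
    (hp : Measurable p) {s : ι → Set Y} (hs : ∀ i, MeasurableSet (s i)) {D : Set X}
    (hD : MeasurableSet D) (hDμ : ∀ᵐ x ∂μ, x ∈ D)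
    (hsep : ∀ x ∈ D, ∀ y ∈ D, (∀ i, p x ∈ s i ↔ p y ∈ s i) → p x = p y)
    {B : Set Y} (hB : NullMeasurableSet B (μ.map p)) :
    ∃ C, MeasurableSet[MeasurableSpace.generateFrom (Set.range s)] C ∧
      μ.map p (symmDiff B C) = 0 := by
  obtain ⟨B', hB', hBB'⟩ := hB
  classical
  -- The itinerary map: pullbacks under `F` of Borel sets lie in the σ-algebra generated by the `s
  -- i`. Countability of `ι` makes the target Polish.
  let F : Y → ι → Bool := fun y i => decide (y ∈ s i)
  have hFm : Measurable[MeasurableSpace.generateFrom (Set.range s)] F := by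
    refine @measurable_pi_lambda _ _ _ (_) _ _ fun i => ?_
    refine @measurable_to_bool _ (_) _ ?_
    have : (fun y => decide (y ∈ s i)) ⁻¹' {true} = s i := by
      ext y; simp
    rw [this]
    exact MeasurableSpace.measurableSet_generateFrom ⟨i, rfl⟩
  have hle : MeasurableSpace.generateFrom (Set.range s) ≤ ‹MeasurableSpace Y› := by
    apply MeasurableSpace.generateFrom_le
    rintro _ ⟨i, rfl⟩
    exact hs i
  have hFp : Measurable (F ∘ p) := (hFm.mono hle le_rfl).comp hp
  have h1 := ((hp hB').inter hD).analyticSet_image hFp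
  have h2 := ((hp hB').compl.inter hD).analyticSet_image hFp
  -- The two analytic images are disjoint: equal itineraries on `D` force equal values of `p`, and
  -- `B'` is a set of such values.
  obtain ⟨u, hu1, hu2, hu⟩ := h1.measurablySeparable h2 (by
    rw [Set.disjoint_left]
    rintro _ ⟨x, ⟨hxB, hxD⟩, rfl⟩ ⟨y, ⟨hyB, hyD⟩, hxy⟩
    apply hyB
    have : p y = p x := hsep y hyD x hxD fun i => decide_eq_decide.1 (congrFun hxy i)
    simpa [this] using hxB)
  refine ⟨F ⁻¹' u, hFm hu, ?_⟩
  have hC : MeasurableSet (F ⁻¹' u) := hle _ (hFm hu)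
  rw [measure_symmDiff_eq_zero_iff]
  refine hBB'.trans ?_
  rw [← measure_symmDiff_eq_zero_iff, Measure.map_apply hp (hB'.symmDiff hC)]
  -- `B'` and `F ⁻¹' u` can disagree at `p x` only for `x` outside `D`.
  refine measure_mono_null (fun x hx => ?_) (ae_iff.1 hDμ)
  intro hxD
  rcases hx with ⟨hxB, hxu⟩ | ⟨hxu, hxB⟩
  · exact hxu (hu1 ⟨x, ⟨hxB, hxD⟩, rfl⟩)
  · exact Set.disjoint_left.1 hu2 ⟨x, ⟨hxB, hxD⟩, rfl⟩ hxu

theorem mainTheorem1 {A : Type*} [Fintype A] [Nontrivial A] [MeasurableSpace A]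
    [MeasurableSingletonClass A] (G : Subgroup (TreeAut A)) [Countable G]
    (hG : IsWeaklyBranch G) (n : ℕ) :
    IsTotallyNonFree G (symPowerMeasure (bernoulliMeasure A) n) := by
  have hfix (g : G) : MeasurableSet {y : SymPower (Boundary A) n | g • y = y} :=
    SymPower.measurableSet_fixed (Boundary.measurable_smul g.1)
  refine ⟨fun g => SymPower.measurePreserving_smul (measurePreserving_smul_bernoulliMeasure g.1),
    hfix, fun B hB => ?_⟩
  have hD : MeasurableSet {x : Fin n → Boundary A | Function.Injective x} := by
    simp only [Function.Injective, Set.ofPred_forall]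
    refine .iInter fun i => .iInter fun j => ?_
    exact (measurableSet_eq_fun (f := fun x : Fin n → Boundary A => x i) (g := fun x => x j)
      (by fun_prop) (by fun_prop)).imp (.const _)
  refine exists_measurableSet_generateFrom_symmDiff_null SymPower.measurable_proj hfix hD
    (ae_injective_pi _ n) (fun x hx y _ h => ?_) hB
  by_contra hxy
  obtain ⟨g, hgx, hgy⟩ := hG.exists_smul_ne_and_smul_eq hx hxy
  exact hgx ((h g).2 hgy)
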